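/- For a finite simple graph $G$ of order $N\ge 2$, let $\lambda_1(G)\ge\lambda_2(G)\ge\dots\ge\lambda_N(G)$ be the eigenvalues of its adjacency matrix, listed with multiplicity; the adjacency spectral gap of $G$ is $\lambda_1(G)-\lambda_2(G)$. For $n\ge 3$ let $A_n$ be the alternating group of degree $n$ and let $T$ be the set of all $3$-cycles on $\{1,\dots,n\}$. The complete alternating group graph $CAG_n=\mathrm{Cay}(A_n,T)$ is the graph with vertex set $A_n$ and edge set $\{\{\gamma,t\gamma\} : \gamma\in A_n,\ t\in T\}$. Then, for every $n\ge 3$, the two largest eigenvalues of $CAG_n$ are $$\lambda_1(CAG_n)=2\binom{n}{3}\qquad\text{and}\qquad \lambda_2(CAG_n)=\tfrac13\,n(n-2)(n-4).$$ In particular, the adjacency spectral gap of $CAG_n$ is $n^2-2n$. -/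

import Mathlib

open SimpleGraph

/-- The set of all 3-cycles on `n` letters, as a subset of the alternating group. -/
def threeCycles (n : ℕ) : Set (alternatingGroup (Fin n)) :=
  {σ | (σ : Equiv.Perm (Fin n)).IsThreeCycle}

/-- The complete alternating group graph `CAG_n`: the Cayley graph of the alternating group with
respect to all 3-cycles. Vertices `γ` and `γ * t` are joined; in Mathlib's convention `γ * t` means
first `t`, then `γ`. -/
def completeAlternatingGroupGraph (n : ℕ) : SimpleGraph (alternatingGroup (Fin n)) :=
  mulCayley (threeCycles n)

instance threeCycles.decidableMem (n : ℕ) : DecidablePred (· ∈ threeCycles n) := fun σ =>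
  inferInstanceAs (Decidable ((σ : Equiv.Perm (Fin n)).cycleType = {3}))

instance completeAlternatingGroupGraph.decidableAdj (n : ℕ) :
    DecidableRel (completeAlternatingGroupGraph n).Adj :=
  inferInstanceAs (DecidableRel (mulCayley (threeCycles n)).Adj)

/-- The adjacency eigenvalues of a finite graph, listed with multiplicity in decreasing order.
The index starts at `0`, so the largest one has index `0` and the second largest has index `1`. -/
noncomputable def SimpleGraph.adjEigenvalue {V : Type*} [Fintype V] [DecidableEq V]
    (G : SimpleGraph V) [DecidableRel G.Adj] (k : Fin (Fintype.card V)) : ℝ :=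
  (isHermitian_adjMatrix ℝ G).eigenvalues₀ k

/-- The adjacency spectral gap: the largest minus the second largest adjacency eigenvalue
(with multiplicity), for a graph on at least two vertices. -/
noncomputable def SimpleGraph.adjSpectralGap {V : Type*} [Fintype V] [DecidableEq V]
    (G : SimpleGraph V) [DecidableRel G.Adj] (h : 1 < Fintype.card V) : ℝ :=
  G.adjEigenvalue ⟨0, Nat.zero_lt_of_lt h⟩ - G.adjEigenvalue ⟨1, h⟩

/-- `A_n` has at least two elements when `3 ≤ n`. -/
theorem one_lt_card_alternatingGroup {n : ℕ} (hn : 3 ≤ n) :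
    1 < Fintype.card (alternatingGroup (Fin n)) := by
  have := alternatingGroup.nontrivial_of_three_le_card (α := Fin n) (by simpa using hn)
  exact Fintype.one_lt_card

/-!
The constants are eigenvectors of `CAG_n` for its degree, the number `2 * n.choose 3` of `3`-cycles.
The theorem amounts to saying that on functions of sum zero the Laplacian has smallest eigenvalue
`n (n - 2)`.

The lower bound is a Poincaré inequality (`poincare_threeCycleEnergy`), proved by induction on the
number `n` of letters. Let `L` be the Laplacian on `n` letters and `L_i` the one built from the
`3`-cycles fixing the letter `i`. A `3`-cycle fixes `n - 3` letters, so `∑ i, L_i = (n - 3) L`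
(`sum_sum_threeCyclesOn_erase`). On each coset of the stabilizer of `i` the induction hypothesis
applies (`mul_le_sum_threeCyclesOn_erase`), so that `L_i ≥ (n - 1) (n - 3) (1 - P_i)`, where `P_i`
is the projection onto the functions of `g i`. Hence `L ≥ (n - 1) (n - ∑ i, P_i)`. By
`2`-transitivity of the alternating group on at least four letters, `∑ i, P_i ≤ n / (n - 1)` on
functions of sum zero (`sum_sq_sum_filter_apply_le`), which gives
`L ≥ (n - 1) (n - n / (n - 1)) = n (n - 2)`: the induction closes without loss. It starts at three
letters, where the graph is a triangle.

The bound is attained by `g ↦ u (g i)` for a function `u` on the letters of sum zero, because for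
`j ≠ i` exactly `n - 2` of the `3`-cycles carry `i` to `j` (`sum_apply_threeCyclesOn_univ`).
Since the eigenvalue of the constants is strictly larger, both values are read off from the sorted
list of eigenvalues (`Matrix.IsHermitian.eigenvalues₀_zero_one_eq`).

The even permutations of a finset `s` of letters are treated as a finset of permutations of the
ambient type, so that the induction removes letters from `s` without changing the type.
-/

open Finset Equiv Equiv.Perm

variable {α : Type*} [Fintype α] [DecidableEq α]

/-! ### Even permutations of a finset of letters -/

/-- The even permutations of `α` fixing every point outside `s`. -/
def evenPermsOn (s : Finset α) : Finset (Perm α) :=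
  {g | sign g = 1 ∧ ∀ x ∉ s, g x = x}

/-- The `3`-cycles of `α` fixing every point outside `s`; a `3`-cycle is a permutation moving
exactly three points. -/
def threeCyclesOn (s : Finset α) : Finset (Perm α) :=
  {t | t.support.card = 3 ∧ ∀ x ∉ s, t x = x}

theorem mem_evenPermsOn {s : Finset α} {g : Perm α} :
    g ∈ evenPermsOn s ↔ sign g = 1 ∧ ∀ x ∉ s, g x = x := by
  simp [evenPermsOn]

theorem mem_threeCyclesOn {s : Finset α} {t : Perm α} :
    t ∈ threeCyclesOn s ↔ t.support.card = 3 ∧ ∀ x ∉ s, t x = x := by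
  simp [threeCyclesOn]

theorem one_mem_evenPermsOn (s : Finset α) : (1 : Perm α) ∈ evenPermsOn s := by
  simp [mem_evenPermsOn]

theorem mul_mem_evenPermsOn {s : Finset α} {g h : Perm α} (hg : g ∈ evenPermsOn s)
    (hh : h ∈ evenPermsOn s) : g * h ∈ evenPermsOn s := by
  rw [mem_evenPermsOn] at *
  refine ⟨by simp [hg.1, hh.1], fun x hx => ?_⟩
  rw [Perm.mul_apply, hh.2 x hx, hg.2 x hx]

theorem inv_mem_evenPermsOn {s : Finset α} {g : Perm α} (hg : g ∈ evenPermsOn s) :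
    g⁻¹ ∈ evenPermsOn s := by
  rw [mem_evenPermsOn] at *
  refine ⟨by simp [hg.1], fun x hx => ?_⟩
  rw [Perm.inv_eq_iff_eq, hg.2 x hx]

theorem evenPermsOn_mono {s u : Finset α} (h : s ⊆ u) : evenPermsOn s ⊆ evenPermsOn u := by
  intro g hg
  rw [mem_evenPermsOn] at *
  exact ⟨hg.1, fun x hx => hg.2 x fun hs => hx (h hs)⟩

theorem threeCyclesOn_subset_evenPermsOn (s : Finset α) : threeCyclesOn s ⊆ evenPermsOn s := by
  intro t ht
  rw [mem_threeCyclesOn] at ht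
  exact mem_evenPermsOn.2 ⟨(card_support_eq_three_iff.1 ht.1).sign, ht.2⟩

theorem apply_mem_of_mem_evenPermsOn {s : Finset α} {g : Perm α} (hg : g ∈ evenPermsOn s)
    {x : α} (hx : x ∈ s) : g x ∈ s := by
  by_contra h
  have h1 := (mem_evenPermsOn.1 hg).2 _ h
  exact h (by rwa [g.injective h1])

theorem sum_mul_left_evenPermsOn {s : Finset α} {a : Perm α} (ha : a ∈ evenPermsOn s)
    (φ : Perm α → ℝ) : ∑ g ∈ evenPermsOn s, φ (a * g) = ∑ g ∈ evenPermsOn s, φ g :=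
  Finset.sum_nbij' (a * ·) (a⁻¹ * ·) (fun _ h => mul_mem_evenPermsOn ha h)
    (fun _ h => mul_mem_evenPermsOn (inv_mem_evenPermsOn ha) h) (by simp) (by simp) (by simp)

theorem sum_mul_right_evenPermsOn {s : Finset α} {a : Perm α} (ha : a ∈ evenPermsOn s)
    (φ : Perm α → ℝ) : ∑ g ∈ evenPermsOn s, φ (g * a) = ∑ g ∈ evenPermsOn s, φ g :=
  Finset.sum_nbij' (· * a) (· * a⁻¹) (fun _ h => mul_mem_evenPermsOn h ha)
    (fun _ h => mul_mem_evenPermsOn h (inv_mem_evenPermsOn ha)) (by simp) (by simp) (by simp)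

/-- The alternating group on at least four letters is `2`-transitive: a permutation with the
prescribed values is corrected, if odd, by a transposition of two further letters. -/
theorem exists_mem_evenPermsOn_apply_eq {s : Finset α} (hs : 4 ≤ #s) {i j x y : α} (hi : i ∈ s)
    (hj : j ∈ s) (hx : x ∈ s) (hy : y ∈ s) (hij : i ≠ j) (hxy : x ≠ y) :
    ∃ g ∈ evenPermsOn s, g i = x ∧ g j = y := by
  set σ : Perm α := swap (swap i x j) y * swap i x with hσ
  have hz : swap i x j ∈ s := by
    by_cases h1 : j = x
    · subst h1; simpa using hi
    · rwa [swap_apply_of_ne_of_ne hij.symm h1]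
  have hzx : swap i x j ≠ x := by
    intro h
    rw [swap_apply_eq_iff, swap_apply_right] at h
    exact hij h.symm
  have h1 : σ i = x := by
    simp [hσ, Perm.mul_apply, swap_apply_of_ne_of_ne hzx.symm hxy]
  have h2 : σ j = y := by simp [hσ, Perm.mul_apply]
  have h3 : ∀ w ∉ s, σ w = w := by
    intro w hw
    have hne : ∀ z ∈ s, w ≠ z := fun z hz h => hw (h ▸ hz)
    rw [hσ, Perm.mul_apply, swap_apply_of_ne_of_ne (hne i hi) (hne x hx),
      swap_apply_of_ne_of_ne (hne _ hz) (hne y hy)]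
  rcases Int.units_eq_one_or (sign σ) with h | h
  · exact ⟨σ, mem_evenPermsOn.2 ⟨h, h3⟩, h1, h2⟩
  · have hcard : 1 < #((s.erase i).erase j) := by
      rw [card_erase_of_mem (mem_erase.2 ⟨hij.symm, hj⟩), card_erase_of_mem hi]; omega
    obtain ⟨a, ha, b, hb, hab⟩ := Finset.one_lt_card.1 hcard
    simp only [mem_erase] at ha hb
    refine ⟨σ * swap a b, mem_evenPermsOn.2 ⟨by simp [h, sign_swap hab], fun w hw => ?_⟩, ?_, ?_⟩
    · rw [Perm.mul_apply, swap_apply_of_ne_of_ne (ne_of_mem_of_not_mem ha.2.2 hw).symm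
        (ne_of_mem_of_not_mem hb.2.2 hw).symm, h3 w hw]
    · rw [Perm.mul_apply, swap_apply_of_ne_of_ne (Ne.symm ha.2.1) (Ne.symm hb.2.1), h1]
    · rw [Perm.mul_apply, swap_apply_of_ne_of_ne (Ne.symm ha.1) (Ne.symm hb.1), h2]

theorem card_filter_apply_apply_eq {s : Finset α} (hs : 4 ≤ #s) {i j x y i' j' x' y' : α}
    (hi : i ∈ s) (hj : j ∈ s) (hx : x ∈ s) (hy : y ∈ s) (hij : i ≠ j) (hxy : x ≠ y)
    (hi' : i' ∈ s) (hj' : j' ∈ s) (hx' : x' ∈ s) (hy' : y' ∈ s) (hij' : i' ≠ j') (hxy' : x' ≠ y') :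
    #{g ∈ evenPermsOn s | g i = x ∧ g j = y} = #{g ∈ evenPermsOn s | g i' = x' ∧ g j' = y'} := by
  obtain ⟨a, ha, ha1, ha2⟩ := exists_mem_evenPermsOn_apply_eq hs hi' hj' hi hj hij' hij
  obtain ⟨b, hb, hb1, hb2⟩ := exists_mem_evenPermsOn_apply_eq hs hx hy hx' hy' hxy hxy'
  have key : ∀ g : Perm α, (b * g * a) i' = x' ∧ (b * g * a) j' = y' ↔ g i = x ∧ g j = y := by
    intro g
    simp only [Perm.mul_apply, ha1, ha2, ← hb1, ← hb2, b.injective.eq_iff]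
  refine Finset.card_nbij' (fun g => b * g * a) (fun g => b⁻¹ * g * a⁻¹) ?_ ?_ ?_ ?_
  · intro g hg
    simp only [coe_filter, Set.mem_ofPred_eq] at hg ⊢
    exact ⟨mul_mem_evenPermsOn (mul_mem_evenPermsOn hb hg.1) ha, (key g).2 hg.2⟩
  · intro g hg
    simp only [coe_filter, Set.mem_ofPred_eq] at hg ⊢
    refine ⟨mul_mem_evenPermsOn (mul_mem_evenPermsOn (inv_mem_evenPermsOn hb) hg.1)
      (inv_mem_evenPermsOn ha), (key _).1 ?_⟩
    simpa [mul_assoc] using hg.2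
  · intro g _; simp [mul_assoc]
  · intro g _; simp [mul_assoc]

/-- The order of the pointwise stabilizer of two letters in the even permutations of `s`, as a
number independent of the letters. -/
theorem exists_card_filter_apply_apply_eq {s : Finset α} (hs : 4 ≤ #s) : ∃ c : ℕ, 0 < c ∧
    ∀ i ∈ s, ∀ j ∈ s, ∀ x ∈ s, ∀ y ∈ s, i ≠ j → x ≠ y →
      #{g ∈ evenPermsOn s | g i = x ∧ g j = y} = c := by
  obtain ⟨a, ha, b, hb, hab⟩ := Finset.one_lt_card.1 (show 1 < #s by omega)
  refine ⟨#{g ∈ evenPermsOn s | g a = a ∧ g b = b}, Finset.card_pos.2 ⟨1, ?_⟩, ?_⟩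
  · simp [one_mem_evenPermsOn]
  · intro i hi j hj x hx y hy hij hxy
    exact card_filter_apply_apply_eq hs hi hj hx hy hij hxy ha hb ha hb hab hab

/-- The sum over a coset `{g | g i = x}` of the stabilizer of `i`, parametrized by that
stabilizer, which is the group of even permutations of `s.erase i`. -/
theorem sum_filter_apply_eq {s : Finset α} {i x : α} (hi : i ∈ s) {a : Perm α}
    (ha : a ∈ evenPermsOn s) (hax : a i = x) (φ : Perm α → ℝ) :
    ∑ g ∈ evenPermsOn s with g i = x, φ g = ∑ h ∈ evenPermsOn (s.erase i), φ (a * h) := by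
  symm
  refine Finset.sum_nbij' (a * ·) (a⁻¹ * ·) ?_ ?_ (by simp) (by simp) (by simp)
  · intro h hh
    simp only [mem_filter]
    refine ⟨mul_mem_evenPermsOn ha (evenPermsOn_mono (erase_subset _ _) hh), ?_⟩
    rw [Perm.mul_apply, (mem_evenPermsOn.1 hh).2 i (by simp), hax]
  · intro g hg
    simp only [mem_filter] at hg
    have h1 := mem_evenPermsOn.1 (mul_mem_evenPermsOn (inv_mem_evenPermsOn ha) hg.1)
    refine mem_evenPermsOn.2 ⟨h1.1, fun w hw => ?_⟩
    rw [mem_erase, not_and_or, not_not] at hw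
    rcases hw with rfl | hw
    · rw [Perm.mul_apply, Perm.inv_eq_iff_eq, hg.2, hax]
    · exact h1.2 w hw

theorem sum_sum_filter_apply_eq {s : Finset α} {i : α} (hi : i ∈ s) (φ : Perm α → ℝ) :
    ∑ x ∈ s, ∑ g ∈ evenPermsOn s with g i = x, φ g = ∑ g ∈ evenPermsOn s, φ g :=
  Finset.sum_fiberwise_of_maps_to (fun _ hg => apply_mem_of_mem_evenPermsOn hg hi) φ

/-! ### Correlations of the values of a random even permutation -/

section Transitive

variable {s : Finset α} {c : ℕ}

theorem card_filter_apply_eq (hs : 4 ≤ #s)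
    (hc : ∀ i ∈ s, ∀ j ∈ s, ∀ x ∈ s, ∀ y ∈ s, i ≠ j → x ≠ y →
      #{g ∈ evenPermsOn s | g i = x ∧ g j = y} = c) {i x : α} (hi : i ∈ s) (hx : x ∈ s) :
    #{g ∈ evenPermsOn s | g i = x} = (#s - 1) * c := by
  obtain ⟨j, hj, hji⟩ := Finset.exists_mem_ne (show 1 < #s by omega) i
  rw [Finset.card_eq_sum_card_fiberwise (f := fun g : Perm α => g j) (t := s.erase x),
    Finset.sum_const_nat (m := c), card_erase_of_mem hx]
  · intro y hy
    rw [mem_erase] at hy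
    rw [filter_filter]
    exact hc i hi j hj x hx y hy.2 hji.symm hy.1.symm
  · intro g hg
    simp only [coe_filter, Set.mem_ofPred_eq] at hg
    simp only [coe_erase, Set.mem_sdiff, mem_coe, Set.mem_singleton_iff]
    exact ⟨apply_mem_of_mem_evenPermsOn hg.1 hj, fun h => hji (g.injective (h.trans hg.2.symm))⟩

theorem sum_apply_evenPermsOn (hs : 4 ≤ #s)
    (hc : ∀ i ∈ s, ∀ j ∈ s, ∀ x ∈ s, ∀ y ∈ s, i ≠ j → x ≠ y →
      #{g ∈ evenPermsOn s | g i = x ∧ g j = y} = c) {i : α} (hi : i ∈ s) (u : α → ℝ) :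
    ∑ g ∈ evenPermsOn s, u (g i) = ((#s : ℝ) - 1) * c * ∑ x ∈ s, u x := by
  rw [← sum_sum_filter_apply_eq hi, Finset.mul_sum]
  refine Finset.sum_congr rfl fun x hx => ?_
  rw [Finset.sum_congr rfl (g := fun _ => u x) (fun g hg => by rw [(mem_filter.1 hg).2]),
    Finset.sum_const, card_filter_apply_eq hs hc hi hx, nsmul_eq_mul, Nat.cast_mul,
    Nat.cast_sub (by omega), Nat.cast_one]

/-- For `i ≠ j` the pair `(g i, g j)` is equidistributed over the pairs of distinct letters, so
that for `v` of sum zero the correlation of `u (g i)` and `v (g j)` is minus a diagonal sum. -/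
theorem sum_apply_mul_apply_evenPermsOn
    (hc : ∀ i ∈ s, ∀ j ∈ s, ∀ x ∈ s, ∀ y ∈ s, i ≠ j → x ≠ y →
      #{g ∈ evenPermsOn s | g i = x ∧ g j = y} = c) {i j : α} (hi : i ∈ s) (hj : j ∈ s)
    (hij : i ≠ j) (u v : α → ℝ) (hv : ∑ x ∈ s, v x = 0) :
    ∑ g ∈ evenPermsOn s, u (g i) * v (g j) = -(c * ∑ x ∈ s, u x * v x) := by
  rw [← sum_sum_filter_apply_eq hi, Finset.mul_sum, ← Finset.sum_neg_distrib]
  refine Finset.sum_congr rfl fun x hx => ?_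
  have h1 : ∑ y ∈ s.erase x, v y = - v x := by
    rw [← Finset.add_sum_erase s v hx] at hv; linarith
  rw [← Finset.sum_fiberwise_of_maps_to (g := fun g : Perm α => g j) (t := s.erase x),
    Finset.sum_congr rfl (g := fun y => c * u x * v y), ← Finset.mul_sum, h1]
  · ring
  · intro y hy
    rw [mem_erase] at hy
    rw [filter_filter, Finset.sum_congr rfl (g := fun _ => u x * v y)
      (fun g hg => by rw [(mem_filter.1 hg).2.1, (mem_filter.1 hg).2.2]), Finset.sum_const,
      hc i hi j hj x hx y hy.2 hij hy.1.symm, nsmul_eq_mul, mul_assoc]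
  · intro g hg
    rw [mem_filter] at hg
    rw [mem_erase]
    exact ⟨fun h => hij (g.injective (hg.2.trans h.symm)), apply_mem_of_mem_evenPermsOn hg.1 hj⟩

/-- Bessel-type inequality for the orthogonal projections onto the functions of a single value
`g i`: on functions of sum zero the sum of these `#s` projections is at most `#s / (#s - 1)`. -/
theorem sum_sq_sum_filter_apply_le (hs : 4 ≤ #s)
    (hc : ∀ i ∈ s, ∀ j ∈ s, ∀ x ∈ s, ∀ y ∈ s, i ≠ j → x ≠ y →
      #{g ∈ evenPermsOn s | g i = x ∧ g j = y} = c) (f : Perm α → ℝ)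
    (hf : ∑ g ∈ evenPermsOn s, f g = 0) :
    ∑ i ∈ s, ∑ x ∈ s, (∑ g ∈ evenPermsOn s with g i = x, f g) ^ 2 ≤
      #s * c * ∑ g ∈ evenPermsOn s, f g ^ 2 := by
  set U : α → α → ℝ := fun i x => ∑ g ∈ evenPermsOn s with g i = x, f g with hU
  set Q : ℝ := ∑ i ∈ s, ∑ x ∈ s, U i x ^ 2 with hQ
  have hU0 : ∀ i ∈ s, ∑ x ∈ s, U i x = 0 := fun i hi => by
    rw [hU, sum_sum_filter_apply_eq hi, hf]
  -- The inner product of `f` with `w g = ∑ i, U i (g i)` is `Q`.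
  have h1 : ∑ g ∈ evenPermsOn s, f g * ∑ i ∈ s, U i (g i) = Q := by
    simp_rw [Finset.mul_sum]
    rw [Finset.sum_comm, hQ]
    refine Finset.sum_congr rfl fun i hi => ?_
    rw [← sum_sum_filter_apply_eq hi]
    refine Finset.sum_congr rfl fun x hx => ?_
    rw [sq, Finset.sum_mul]
    exact Finset.sum_congr rfl fun g hg => by rw [(mem_filter.1 hg).2]
  have h2 : ∑ g ∈ evenPermsOn s, (∑ i ∈ s, U i (g i)) ^ 2 ≤ #s * c * Q := by
    have h3 : ∀ i ∈ s, ∀ j ∈ s, ∑ g ∈ evenPermsOn s, U i (g i) * U j (g j) =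
        (if i = j then #s * c * ∑ x ∈ s, U i x ^ 2 else 0) - c * ∑ x ∈ s, U i x * U j x := by
      intro i hi j hj
      split_ifs with hij
      · subst hij
        rw [sum_apply_evenPermsOn hs hc hi (fun x => U i x * U i x)]
        simp_rw [← sq]
        ring
      · rw [sum_apply_mul_apply_evenPermsOn hc hi hj hij _ _ (hU0 j hj)]
        ring
    have h4 : ∑ x ∈ s, (∑ i ∈ s, U i x) ^ 2 = ∑ i ∈ s, ∑ j ∈ s, ∑ x ∈ s, U i x * U j x := by
      simp_rw [sq, Finset.sum_mul_sum]
      rw [Finset.sum_comm]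
      exact Finset.sum_congr rfl fun i _ => Finset.sum_comm
    have h5 : ∑ g ∈ evenPermsOn s, (∑ i ∈ s, U i (g i)) ^ 2 =
        #s * c * Q - c * ∑ x ∈ s, (∑ i ∈ s, U i x) ^ 2 := by
      calc ∑ g ∈ evenPermsOn s, (∑ i ∈ s, U i (g i)) ^ 2
          = ∑ i ∈ s, ∑ j ∈ s, ∑ g ∈ evenPermsOn s, U i (g i) * U j (g j) := by
            simp_rw [sq, Finset.sum_mul_sum]
            rw [Finset.sum_comm]
            exact Finset.sum_congr rfl fun i _ => Finset.sum_comm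
        _ = ∑ i ∈ s, (#s * c * ∑ x ∈ s, U i x ^ 2 - ∑ j ∈ s, c * ∑ x ∈ s, U i x * U j x) := by
            refine Finset.sum_congr rfl fun i hi => ?_
            rw [Finset.sum_congr rfl (h3 i hi), Finset.sum_sub_distrib, Finset.sum_ite_eq,
              if_pos hi]
        _ = _ := by
            rw [Finset.sum_sub_distrib, h4, hQ]
            simp_rw [Finset.mul_sum]
    rw [h5]
    have : 0 ≤ (c : ℝ) * ∑ x ∈ s, (∑ i ∈ s, U i x) ^ 2 := by positivity
    linarith
  have h5 : 0 ≤ Q := by positivity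
  have h6 := Finset.sum_mul_sq_le_sq_mul_sq (evenPermsOn s) f (fun g => ∑ i ∈ s, U i (g i))
  rw [h1] at h6
  have h7 : 0 ≤ ∑ g ∈ evenPermsOn s, f g ^ 2 := by positivity
  rcases h5.eq_or_lt with h | h
  · rw [← h]; positivity
  · refine le_of_mul_le_mul_right ?_ h
    calc Q * Q = Q ^ 2 := (sq Q).symm
      _ ≤ _ := h6
      _ ≤ (∑ g ∈ evenPermsOn s, f g ^ 2) * (#s * c * Q) := mul_le_mul_of_nonneg_left h2 h7
      _ = _ := by ring

end Transitive

/-! ### The Poincaré inequality -/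

/-- The Dirichlet form of the complete alternating group graph on the letters `s`; every edge is
counted twice, once for each orientation. -/
def threeCycleEnergy (s : Finset α) (f : Perm α → ℝ) : ℝ :=
  ∑ t ∈ threeCyclesOn s, ∑ g ∈ evenPermsOn s, (f g - f (g * t)) ^ 2

/-- A Poincaré inequality for functions of sum zero gives one for the variance. -/
theorem mul_variance_le_of_poincare {s : Finset α} {C : ℝ}
    (h : ∀ f : Perm α → ℝ, ∑ g ∈ evenPermsOn s, f g = 0 →
      C * ∑ g ∈ evenPermsOn s, f g ^ 2 ≤ threeCycleEnergy s f) (f : Perm α → ℝ) :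
    C * (#(evenPermsOn s) * ∑ g ∈ evenPermsOn s, f g ^ 2 - (∑ g ∈ evenPermsOn s, f g) ^ 2) ≤
      #(evenPermsOn s) * threeCycleEnergy s f := by
  set N : ℝ := (#(evenPermsOn s) : ℝ) with hN
  have hN0 : 0 < N := by
    rw [hN]; exact_mod_cast Finset.card_pos.2 ⟨1, one_mem_evenPermsOn s⟩
  set S := ∑ g ∈ evenPermsOn s, f g with hS
  have h1 := h (fun g => f g - S / N) (by
    rw [Finset.sum_sub_distrib, Finset.sum_const, nsmul_eq_mul, ← hN, ← hS]
    field_simp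
    ring)
  have h2 : ∑ g ∈ evenPermsOn s, (f g - S / N) ^ 2 =
      ∑ g ∈ evenPermsOn s, f g ^ 2 - S ^ 2 / N := by
    simp_rw [sub_sq, Finset.sum_add_distrib, Finset.sum_sub_distrib, Finset.sum_const,
      nsmul_eq_mul, ← Finset.sum_mul, ← Finset.mul_sum, ← hN, ← hS]
    field_simp
    ring
  have h3 : threeCycleEnergy s (fun g => f g - S / N) = threeCycleEnergy s f := by
    simp [threeCycleEnergy]
  rw [h2, h3] at h1
  calc C * (N * ∑ g ∈ evenPermsOn s, f g ^ 2 - S ^ 2)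
      = N * (C * (∑ g ∈ evenPermsOn s, f g ^ 2 - S ^ 2 / N)) := by field_simp
    _ ≤ _ := mul_le_mul_of_nonneg_left h1 hN0.le

/-- A `3`-cycle supported in `s` fixes `#s - 3` letters of `s`. -/
theorem sum_sum_threeCyclesOn_erase (s : Finset α) (φ : Perm α → ℝ) :
    ∑ i ∈ s, ∑ t ∈ threeCyclesOn (s.erase i), φ t =
      ((#s : ℝ) - 3) * ∑ t ∈ threeCyclesOn s, φ t := by
  have h1 : ∀ i ∈ s, ∑ t ∈ threeCyclesOn (s.erase i), φ t =
      ∑ t ∈ threeCyclesOn s, if t i = i then φ t else 0 := by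
    intro i hi
    rw [← Finset.sum_filter]
    refine Finset.sum_congr (Finset.ext fun t => ?_) fun _ _ => rfl
    simp only [mem_threeCyclesOn, mem_filter, mem_erase, not_and_or, not_not]
    constructor
    · exact fun h => ⟨⟨h.1, fun x hx => h.2 x (Or.inr hx)⟩, h.2 i (Or.inl rfl)⟩
    · rintro ⟨⟨h, h'⟩, h''⟩
      exact ⟨h, fun x hx => hx.elim (fun e => e ▸ h'') (h' x)⟩
  rw [Finset.sum_congr rfl h1, Finset.sum_comm, Finset.mul_sum]
  refine Finset.sum_congr rfl fun t ht => ?_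
  rw [mem_threeCyclesOn] at ht
  have h2 : ({i ∈ s | t i = i} : Finset α) = s \ t.support := by
    ext x; simp
  have h3 : t.support ⊆ s := fun x hx => by
    by_contra h
    exact mem_support.1 hx (ht.2 x h)
  rw [← Finset.sum_filter, Finset.sum_const, h2, nsmul_eq_mul, Finset.card_sdiff_of_subset h3,
    Nat.cast_sub (Finset.card_le_card h3), ht.1]
  norm_num

theorem mem_threeCyclesOn_of_card_eq_three {s : Finset α} (hs : #s = 3) {g : Perm α}
    (hg : g ∈ evenPermsOn s) (h1 : g ≠ 1) : g ∈ threeCyclesOn s := by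
  rw [mem_evenPermsOn] at hg
  rw [mem_threeCyclesOn]
  refine ⟨?_, hg.2⟩
  have h3 : g.support ⊆ s := fun x hx => by
    by_contra h
    exact mem_support.1 hx (hg.2 x h)
  have h4 := Finset.card_le_card h3
  have h5 : #g.support ≠ 2 := fun h => by
    have := (card_support_eq_two.1 h).sign_eq
    rw [hg.1] at this
    exact absurd this (by decide)
  have h6 := two_le_card_support_of_ne_one h1
  omega

theorem three_le_card_evenPermsOn {s : Finset α} (hs : #s = 3) : 3 ≤ #(evenPermsOn s) := by
  obtain ⟨a, b, c, hab, hac, hbc, rfl⟩ := Finset.card_eq_three.1 hs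
  have hσ := isThreeCycle_swap_mul_swap_same hab hac hbc
  set σ : Perm α := swap a b * swap a c with hσ'
  have hmem : σ ∈ evenPermsOn {a, b, c} := by
    refine mem_evenPermsOn.2 ⟨hσ.sign, fun x hx => ?_⟩
    simp only [mem_insert, mem_singleton, not_or] at hx
    rw [hσ', Perm.mul_apply, swap_apply_of_ne_of_ne hx.1 hx.2.2,
      swap_apply_of_ne_of_ne hx.1 hx.2.1]
  have h1 : σ ≠ 1 := hσ.isCycle.ne_one
  have h2 : σ * σ ≠ 1 := hσ.isThreeCycle_sq.isCycle.ne_one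
  have h3 : #({1, σ, σ * σ} : Finset (Perm α)) = 3 :=
    Finset.card_eq_three.2 ⟨1, σ, σ * σ, h1.symm, h2.symm, by simpa using h1, rfl⟩
  rw [← h3]
  refine Finset.card_le_card fun x hx => ?_
  simp only [mem_insert, mem_singleton] at hx
  rcases hx with rfl | rfl | rfl
  · exact one_mem_evenPermsOn _
  · exact hmem
  · exact mul_mem_evenPermsOn hmem hmem

/-- On three letters the graph is complete, which determines its Dirichlet form. -/
theorem poincare_of_card_eq_three {s : Finset α} (hs : #s = 3) (f : Perm α → ℝ)
    (hf : ∑ g ∈ evenPermsOn s, f g = 0) :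
    6 * ∑ g ∈ evenPermsOn s, f g ^ 2 ≤ threeCycleEnergy s f := by
  have h1 : threeCyclesOn s = (evenPermsOn s).erase 1 := by
    ext t
    rw [mem_erase]
    refine ⟨fun h => ⟨?_, threeCyclesOn_subset_evenPermsOn s h⟩,
      fun h => mem_threeCyclesOn_of_card_eq_three hs h.2 h.1⟩
    rintro rfl
    simp [mem_threeCyclesOn] at h
  have h2 : threeCycleEnergy s f = ∑ t ∈ evenPermsOn s, ∑ g ∈ evenPermsOn s,
      (f g - f (g * t)) ^ 2 := by
    rw [threeCycleEnergy, h1]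
    exact Finset.sum_erase _ (by simp)
  have h3 : ∀ g ∈ evenPermsOn s, ∑ t ∈ evenPermsOn s, (f g - f (g * t)) ^ 2 =
      #(evenPermsOn s) * f g ^ 2 + ∑ t ∈ evenPermsOn s, f t ^ 2 := by
    intro g hg
    rw [sum_mul_left_evenPermsOn hg (fun t => (f g - f t) ^ 2)]
    simp_rw [sub_sq, Finset.sum_add_distrib, Finset.sum_sub_distrib, ← Finset.mul_sum, hf,
      Finset.sum_const, nsmul_eq_mul]
    ring
  rw [h2, Finset.sum_comm, Finset.sum_congr rfl h3, Finset.sum_add_distrib, ← Finset.mul_sum,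
    Finset.sum_const, nsmul_eq_mul, ← add_mul]
  refine mul_le_mul_of_nonneg_right ?_ (by positivity)
  have : (3 : ℝ) ≤ #(evenPermsOn s) := by exact_mod_cast three_le_card_evenPermsOn hs
  linarith

/-- The induction hypothesis for `s.erase i`, applied on every coset of the stabilizer of `i`. -/
theorem mul_le_sum_threeCyclesOn_erase {s : Finset α} (hs : 4 ≤ #s) {c : ℕ} {C : ℝ}
    (hc : ∀ i ∈ s, ∀ j ∈ s, ∀ x ∈ s, ∀ y ∈ s, i ≠ j → x ≠ y →
      #{g ∈ evenPermsOn s | g i = x ∧ g j = y} = c) {i : α} (hi : i ∈ s)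
    (h : ∀ f : Perm α → ℝ, ∑ g ∈ evenPermsOn (s.erase i), f g = 0 →
      C * ∑ g ∈ evenPermsOn (s.erase i), f g ^ 2 ≤ threeCycleEnergy (s.erase i) f)
    (f : Perm α → ℝ) :
    C * (((#s : ℝ) - 1) * c * ∑ g ∈ evenPermsOn s, f g ^ 2 -
        ∑ x ∈ s, (∑ g ∈ evenPermsOn s with g i = x, f g) ^ 2) ≤
      ((#s : ℝ) - 1) * c *
        ∑ t ∈ threeCyclesOn (s.erase i), ∑ g ∈ evenPermsOn s, (f g - f (g * t)) ^ 2 := by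
  have hM : (#(evenPermsOn (s.erase i)) : ℝ) = ((#s : ℝ) - 1) * c := by
    have h1 := sum_filter_apply_eq hi (one_mem_evenPermsOn s) (one_apply i) (fun _ => (1 : ℝ))
    rw [Finset.sum_const, Finset.sum_const, nsmul_one, nsmul_one,
      card_filter_apply_eq hs hc hi hi, Nat.cast_mul, Nat.cast_sub (by omega),
      Nat.cast_one] at h1
    exact h1.symm
  have h2 : ∀ x ∈ s, C * (((#s : ℝ) - 1) * c * ∑ g ∈ evenPermsOn s with g i = x, f g ^ 2 -
      (∑ g ∈ evenPermsOn s with g i = x, f g) ^ 2) ≤ ((#s : ℝ) - 1) * c *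
        ∑ t ∈ threeCyclesOn (s.erase i), ∑ g ∈ evenPermsOn s with g i = x,
          (f g - f (g * t)) ^ 2 := by
    intro x hx
    obtain ⟨j, hj, hji⟩ := Finset.exists_mem_ne (show 1 < #s by omega) i
    obtain ⟨y, hy, hyx⟩ := Finset.exists_mem_ne (show 1 < #s by omega) x
    obtain ⟨a, ha, hax, _⟩ := exists_mem_evenPermsOn_apply_eq hs hi hj hx hy hji.symm hyx.symm
    have h3 := mul_variance_le_of_poincare h (fun g => f (a * g))
    simp_rw [sum_filter_apply_eq hi ha hax]
    simpa only [hM, threeCycleEnergy, mul_assoc] using h3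
  have h4 := Finset.sum_le_sum h2
  rw [← Finset.mul_sum, ← Finset.mul_sum, Finset.sum_sub_distrib, ← Finset.mul_sum,
    sum_sum_filter_apply_eq hi, Finset.sum_comm] at h4
  simpa only [sum_sum_filter_apply_eq hi] using h4

/-- **Poincaré inequality** for the complete alternating group graph on the letters `s`. -/
theorem poincare_threeCycleEnergy {s : Finset α} (hs : 3 ≤ #s) (f : Perm α → ℝ)
    (hf : ∑ g ∈ evenPermsOn s, f g = 0) :
    2 * #s * ((#s : ℝ) - 2) * ∑ g ∈ evenPermsOn s, f g ^ 2 ≤ threeCycleEnergy s f := by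
  generalize hn : #s = n at hs ⊢
  induction n, hs using Nat.le_induction generalizing s f with
  | base =>
    refine le_trans (le_of_eq ?_) (poincare_of_card_eq_three hn f hf)
    norm_num
  | succ k hk ih =>
    have hs : 4 ≤ #s := by omega
    have hkR : (3 : ℝ) ≤ k := by exact_mod_cast hk
    have hcard : (#s : ℝ) = k + 1 := by rw [hn]; push_cast; rfl
    obtain ⟨c, hc0, hc⟩ := exists_card_filter_apply_apply_eq hs
    have hcR : (0 : ℝ) < c := by exact_mod_cast hc0
    have h1 : ∀ i ∈ s, _ := fun i hi => mul_le_sum_threeCyclesOn_erase hs hc hi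
      (fun f hf => ih f hf (by rw [card_erase_of_mem hi, hn]; rfl)) f
    have h2 := Finset.sum_le_sum h1
    have h3 := sum_sq_sum_filter_apply_le hs hc f hf
    rw [← Finset.mul_sum, ← Finset.mul_sum, Finset.sum_sub_distrib, Finset.sum_const,
      nsmul_eq_mul, sum_sum_threeCyclesOn_erase, ← threeCycleEnergy, hcard] at h2
    rw [hcard] at h3
    set P := ∑ g ∈ evenPermsOn s, f g ^ 2
    set R := ∑ i ∈ s, ∑ x ∈ s, (∑ g ∈ evenPermsOn s with g i = x, f g) ^ 2
    set E := threeCycleEnergy s f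
    push_cast
    -- `h2` carries the common factor `k (k - 2) c`, which is positive because `k ≥ 3`.
    have h4 : (0 : ℝ) < k * (k - 2) * c := by
      have : (0 : ℝ) < k - 2 := by linarith
      positivity
    refine le_of_mul_le_mul_left ?_ h4
    have h5 : 2 * (k : ℝ) * (k - 2) * R ≤ 2 * (k : ℝ) * (k - 2) * ((k + 1) * c * P) := by
      refine mul_le_mul_of_nonneg_left h3 ?_
      have : (0 : ℝ) < k - 2 := by linarith
      positivity
    linarith

/-! ### The two largest eigenvalues of a symmetric matrix -/

section Spectral

open Matrix

variable {V : Type*} [Fintype V] [DecidableEq V] {A : Matrix V V ℝ}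

theorem Matrix.IsHermitian.exists_eigenvalues₀_eq (hA : A.IsHermitian) {f : V → ℝ} (hf : f ≠ 0)
    {r : ℝ} (h : A *ᵥ f = r • f) : ∃ k, hA.eigenvalues₀ k = r := by
  have h1 : Module.End.HasEigenvalue (Matrix.toLin' A) r :=
    Module.End.hasEigenvalue_of_hasEigenvector (x := f)
      ⟨Module.End.mem_eigenspace_iff.2 (by simpa using h), hf⟩
  have h2 := h1.mem_spectrum
  rw [Matrix.spectrum_toLin', hA.spectrum_real_eq_range_eigenvalues] at h2
  obtain ⟨v, hv⟩ := h2
  exact ⟨_, hv⟩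

theorem Matrix.IsHermitian.exists_eigenvector_eigenvalues₀ (hA : A.IsHermitian) :
    ∃ v : Fin (Fintype.card V) → V → ℝ, LinearIndependent ℝ v ∧
      ∀ k, A *ᵥ v k = hA.eigenvalues₀ k • v k := by
  set e : Fin (Fintype.card V) ≃ V := Fintype.equivOfCardEq (Fintype.card_fin _) with he
  refine ⟨fun k => ⇑(hA.eigenvectorBasis (e k)), ?_, fun k => ?_⟩
  · have h1 := hA.eigenvectorBasis.toBasis.linearIndependent.map'
      (WithLp.linearEquiv 2 ℝ (V → ℝ)).toLinearMap (LinearEquiv.ker _)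
    have h2 := h1.comp e e.injective
    exact h2
  · rw [hA.mulVec_eigenvectorBasis, Matrix.IsHermitian.eigenvalues, he, Equiv.symm_apply_apply]

/-- If the constants are eigenvectors for `d`, and the largest eigenvalue `m < d` on functions of
sum zero is attained, then `d` and `m` are the two largest eigenvalues. -/
theorem Matrix.IsHermitian.eigenvalues₀_zero_one_eq (hA : A.IsHermitian)
    (hV : 1 < Fintype.card V) {d m : ℝ} (hmd : m < d) (hd : A *ᵥ (fun _ => 1) = d • fun _ => 1)
    (hle : ∀ f : V → ℝ, ∀ r, f ≠ 0 → ∑ v, f v = 0 → A *ᵥ f = r • f → r ≤ m)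
    (hm : ∃ f : V → ℝ, f ≠ 0 ∧ A *ᵥ f = m • f) :
    hA.eigenvalues₀ ⟨0, Nat.zero_lt_of_lt hV⟩ = d ∧ hA.eigenvalues₀ ⟨1, hV⟩ = m := by
  obtain ⟨v, hv, hAv⟩ := hA.exists_eigenvector_eigenvalues₀
  -- An eigenvector for an eigenvalue other than `d` is orthogonal to the constants.
  have horth : ∀ f : V → ℝ, ∀ r, r ≠ d → A *ᵥ f = r • f → ∑ v, f v = 0 := by
    intro f r hr hf
    have h1 : (fun _ => 1) ⬝ᵥ (A *ᵥ f) = (A *ᵥ fun _ => 1) ⬝ᵥ f := by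
      have hT : Aᵀ = A := by simpa using hA.eq
      rw [dotProduct_mulVec, ← mulVec_transpose, hT]
    rw [hf, hd, dotProduct_smul, smul_dotProduct, smul_eq_mul, smul_eq_mul] at h1
    have h2 : (r - d) * ((fun _ => 1) ⬝ᵥ f) = 0 := by linarith
    rcases mul_eq_zero.1 h2 with h | h
    · exact absurd (sub_eq_zero.1 h) hr
    · simpa [dotProduct] using h
  set k0 : Fin (Fintype.card V) := ⟨0, Nat.zero_lt_of_lt hV⟩
  set k1 : Fin (Fintype.card V) := ⟨1, hV⟩
  have h01 : k0 ≠ k1 := by simp [k0, k1, Fin.ext_iff]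
  have hone : (fun _ => 1 : V → ℝ) ≠ 0 := by
    obtain ⟨w⟩ : Nonempty V := Fintype.card_pos_iff.1 (by omega)
    exact fun h => one_ne_zero (congrFun h w)
  have htop : hA.eigenvalues₀ k0 = d := by
    obtain ⟨k, hk⟩ := hA.exists_eigenvalues₀_eq hone hd
    have h1 : hA.eigenvalues₀ k ≤ hA.eigenvalues₀ k0 :=
      hA.eigenvalues₀_antitone (Fin.mk_le_of_le_val (Nat.zero_le _))
    by_contra hne
    have := hle _ _ (hv.ne_zero k0) (horth _ _ hne (hAv k0)) (hAv k0)
    linarith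
  refine ⟨htop, le_antisymm ?_ ?_⟩
  · by_contra hlt
    have hd1 : hA.eigenvalues₀ k1 = d := by
      by_contra hne
      exact hlt (hle _ _ (hv.ne_zero k1) (horth _ _ hne (hAv k1)) (hAv k1))
    -- The eigenspace of `d` would be of dimension at least `2`, hence meet the functions of sum
    -- zero.
    set a := ∑ w, v k0 w with ha
    set b := ∑ w, v k1 w with hb
    have hA0 := hAv k0
    have hA1 := hAv k1
    rw [htop] at hA0
    rw [hd1] at hA1
    have hz : b • v k0 - a • v k1 = 0 := by
      by_contra hne
      have h2 := hle _ d hne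
        (by
          simp only [Pi.sub_apply, Pi.smul_apply, smul_eq_mul, Finset.sum_sub_distrib,
            ← Finset.mul_sum, ← ha, ← hb]
          ring)
        (by rw [mulVec_sub, mulVec_smul, mulVec_smul, hA0, hA1, smul_sub, smul_comm d b,
          smul_comm d a])
      linarith
    have hpair := (LinearIndependent.pair_iff (R := ℝ)).1
      (hv.comp ![k0, k1] (by
        intro p q
        fin_cases p <;> fin_cases q <;> simp [h01, h01.symm]) |> fun h => by
          have : v ∘ ![k0, k1] = ![v k0, v k1] := by ext p; fin_cases p <;> rfl
          rwa [this] at h)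
    obtain ⟨-, ha0⟩ := hpair b (-a) (by rw [neg_smul, ← sub_eq_add_neg, hz])
    have := hle _ d (hv.ne_zero k0) (by rw [← ha]; simpa using ha0) hA0
    linarith
  · obtain ⟨f, hf, hfm⟩ := hm
    obtain ⟨k, hk⟩ := hA.exists_eigenvalues₀_eq hf hfm
    rw [← hk]
    apply hA.eigenvalues₀_antitone
    by_contra hlt
    have : k = k0 := Fin.ext (by
      rw [not_le, Fin.lt_def] at hlt
      exact Nat.lt_one_iff.1 hlt)
    rw [this, htop] at hk
    exact hmd.ne' hk

end Spectral

/-! ### Counting `3`-cycles -/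

section ThreeCycles

/-- A `3`-cycle carrying `i` to `j` is determined by the image of `j`, a third letter. -/
theorem card_filter_threeCyclesOn_univ {i j : α} (hij : i ≠ j) :
    #{t ∈ threeCyclesOn (univ : Finset α) | t i = j} = Fintype.card α - 2 := by
  have h1 : #((univ.erase i).erase j) = Fintype.card α - 2 := by
    rw [card_erase_of_mem (mem_erase.2 ⟨hij.symm, mem_univ _⟩), card_erase_of_mem (mem_univ _),
      card_univ]
    omega
  rw [← h1]
  refine Finset.card_nbij' (fun t => t j) (fun k => swap i j * swap j k) ?_ ?_ ?_ ?_
  · intro t ht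
    simp only [coe_filter, Set.mem_ofPred_eq, mem_threeCyclesOn] at ht
    have h2 := (card_support_eq_three_iff.1 ht.1.1).nodup_iff_mem_support.2
      (mem_support.2 (ht.2.trans_ne hij.symm))
    rw [ht.2] at h2
    simp only [List.nodup_cons, List.mem_cons, List.not_mem_nil, or_false, not_or] at h2
    simp only [coe_erase, Set.mem_sdiff, Set.mem_singleton_iff, mem_coe, mem_univ, true_and]
    grind
  · intro k hk
    simp only [mem_coe, mem_erase, mem_univ, and_true] at hk
    simp only [coe_filter, Set.mem_ofPred_eq, mem_threeCyclesOn, mem_univ, not_true_eq_false,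
      false_implies, implies_true, and_true]
    refine ⟨?_, ?_⟩
    · rw [swap_comm i j]
      exact (isThreeCycle_swap_mul_swap_same hij.symm hk.1.symm hk.2.symm).card_support
    · rw [Perm.mul_apply, swap_apply_of_ne_of_ne hij hk.2.symm, swap_apply_left]
  · intro t ht
    simp only [coe_filter, Set.mem_ofPred_eq, mem_threeCyclesOn] at ht
    have h2 := (card_support_eq_three_iff.1 ht.1.1).eq_swap_mul_swap_iff_mem_support.2
      (mem_support.2 (ht.2.trans_ne hij.symm))
    rw [ht.2] at h2
    exact h2.symm
  · intro k hk
    simp only [mem_coe, mem_erase, mem_univ, and_true] at hk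
    change swap i j (swap j k j) = k
    rw [swap_apply_left, swap_apply_of_ne_of_ne hk.2 hk.1]

theorem sum_apply_threeCyclesOn_univ (hα : 2 ≤ Fintype.card α) (i : α) (u : α → ℝ)
    (hu : ∑ x, u x = 0) :
    ∑ t ∈ threeCyclesOn (univ : Finset α), u (t i) =
      (#(threeCyclesOn (univ : Finset α)) - Fintype.card α * ((Fintype.card α : ℝ) - 2)) * u i := by
  have h1 : ∑ t ∈ threeCyclesOn (univ : Finset α), (u (t i) - u i) =
      ∑ x, ((Fintype.card α : ℝ) - 2) * (u x - u i) := by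
    rw [← Finset.sum_fiberwise_of_maps_to (g := fun t : Perm α => t i) (fun _ _ => mem_univ _)]
    refine Finset.sum_congr rfl fun x _ => ?_
    rw [Finset.sum_congr rfl (g := fun _ => u x - u i)
      (fun t ht => by rw [(mem_filter.1 ht).2]), Finset.sum_const, nsmul_eq_mul]
    by_cases hx : i = x
    · simp [hx]
    · rw [card_filter_threeCyclesOn_univ hx, Nat.cast_sub hα, Nat.cast_ofNat]
  rw [← Finset.mul_sum, Finset.sum_sub_distrib, Finset.sum_sub_distrib, hu, Finset.sum_const,
    Finset.sum_const, nsmul_eq_mul, nsmul_eq_mul, card_univ] at h1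
  linear_combination h1

theorem card_threeCyclesOn_univ (hα : 3 ≤ Fintype.card α) :
    #(threeCyclesOn (univ : Finset α)) = 2 * (Fintype.card α).choose 3 := by
  have h1 : threeCyclesOn (univ : Finset α) = ({g : Perm α | g.cycleType = {3}} : Finset (Perm α)) := by
    ext t
    simp only [mem_threeCyclesOn, card_support_eq_three_iff, mem_univ, not_true_eq_false,
      false_implies, implies_true, and_true, mem_filter, true_and]
    rfl
  have h2 := card_of_cycleType_mul_eq (α := α) {3}
  rw [if_pos (by simpa using hα), ← h1] at h2
  simp only [Multiset.sum_singleton, Multiset.prod_singleton, Multiset.toFinset_singleton,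
    prod_singleton, Multiset.count_singleton_self, Nat.factorial_one, mul_one] at h2
  have h3 := Nat.choose_mul_factorial_mul_factorial hα
  rw [← h3, show Nat.factorial 3 = 6 from rfl] at h2
  have h4 := Nat.factorial_pos (Fintype.card α - 3)
  refine Nat.eq_of_mul_eq_mul_right (Nat.mul_pos h4 (show 0 < 3 by norm_num)) ?_
  rw [h2]
  ring

end ThreeCycles

/-! ### The eigenvalues of the complete alternating group graph -/

section Graph

open Matrix

theorem sum_alternatingGroup_eq (φ : Perm α → ℝ) :
    ∑ g : alternatingGroup α, φ g = ∑ g ∈ evenPermsOn (univ : Finset α), φ g :=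
  (Finset.sum_subtype _ (fun g => by simp [mem_evenPermsOn]) φ).symm

variable {n : ℕ}

theorem adjMatrix_completeAlternatingGroupGraph_mulVec (φ : Perm (Fin n) → ℝ)
    (γ : alternatingGroup (Fin n)) :
    ((completeAlternatingGroupGraph n).adjMatrix ℝ *ᵥ fun g => φ g.1) γ =
      ∑ t ∈ threeCyclesOn univ, φ (γ.1 * t) := by
  rw [adjMatrix_mulVec_apply]
  have hadj : ∀ u, u ∈ (completeAlternatingGroupGraph n).neighborFinset γ ↔
      ((γ⁻¹ * u : alternatingGroup (Fin n)) : Perm (Fin n)).IsThreeCycle := by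
    intro u
    rw [mem_neighborFinset, completeAlternatingGroupGraph, mulCayley_adj]
    simp only [threeCycles, Set.mem_ofPred_eq]
    constructor
    · rintro ⟨-, h | h⟩
      · exact h
      · simpa using h.inv
    · refine fun h => ⟨?_, Or.inl h⟩
      rintro rfl
      simpa using h.isCycle.ne_one
  refine Finset.sum_bij (fun u _ => (γ : Perm (Fin n))⁻¹ * u) ?_ ?_ ?_ ?_
  · intro u hu
    have h := (hadj u).1 hu
    simpa [mem_threeCyclesOn] using h.card_support
  · intro u _ w _ h
    exact Subtype.ext (mul_left_cancel h)
  · intro t ht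
    have h1 := card_support_eq_three_iff.1 (mem_threeCyclesOn.1 ht).1
    refine ⟨γ * ⟨t, h1.mem_alternatingGroup⟩, (hadj _).2 (by simpa using h1), by simp⟩
  · intro u _
    simp

/-- On functions of sum zero the Poincaré inequality bounds the eigenvalues of the graph. -/
theorem eigenvalue_completeAlternatingGroupGraph_le (hn : 3 ≤ n)
    {f : alternatingGroup (Fin n) → ℝ} {r : ℝ} (hf : f ≠ 0) (hf0 : ∑ g, f g = 0)
    (h : (completeAlternatingGroupGraph n).adjMatrix ℝ *ᵥ f = r • f) :
    r ≤ #(threeCyclesOn (univ : Finset (Fin n))) - n * ((n : ℝ) - 2) := by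
  obtain ⟨φ, rfl⟩ : ∃ φ : Perm (Fin n) → ℝ, f = fun g => φ g.1 :=
    ⟨Function.extend Subtype.val f 0,
      funext fun g => (Subtype.val_injective.extend_apply f 0 g).symm⟩
  have h1 : ∀ g ∈ evenPermsOn (univ : Finset (Fin n)),
      ∑ t ∈ threeCyclesOn univ, φ (g * t) = r * φ g := by
    intro g hg
    have h2 : g ∈ alternatingGroup (Fin n) := by simpa using (mem_evenPermsOn.1 hg).1
    have h3 := congrFun h ⟨g, h2⟩
    rwa [adjMatrix_completeAlternatingGroupGraph_mulVec] at h3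
  set P := ∑ g ∈ evenPermsOn (univ : Finset (Fin n)), φ g ^ 2 with hP
  have hPpos : 0 < P := by
    obtain ⟨g, hg⟩ := Function.ne_iff.1 hf
    refine Finset.sum_pos' (fun _ _ => sq_nonneg _) ⟨g, ?_, ?_⟩
    · exact mem_evenPermsOn.2 ⟨mem_alternatingGroup.1 g.2, by simp⟩
    · have : φ g ≠ 0 := hg
      positivity
  rw [sum_alternatingGroup_eq] at hf0
  have h4 := poincare_threeCycleEnergy (s := (univ : Finset (Fin n))) (by simpa using hn) φ hf0
  have h5 : threeCycleEnergy univ φ =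
      2 * (#(threeCyclesOn (univ : Finset (Fin n))) - r) * P := by
    have h6 : threeCycleEnergy univ φ = ∑ t ∈ threeCyclesOn (univ : Finset (Fin n)),
        (2 * P - 2 * ∑ g ∈ evenPermsOn (univ : Finset (Fin n)), φ g * φ (g * t)) := by
      refine Finset.sum_congr rfl fun t ht => ?_
      simp_rw [sub_sq, Finset.sum_add_distrib, Finset.sum_sub_distrib]
      rw [sum_mul_right_evenPermsOn (threeCyclesOn_subset_evenPermsOn _ ht) (fun g => φ g ^ 2)]
      simp_rw [mul_assoc, ← Finset.mul_sum]
      ring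
    have h7 : ∑ t ∈ threeCyclesOn (univ : Finset (Fin n)),
        ∑ g ∈ evenPermsOn (univ : Finset (Fin n)), φ g * φ (g * t) = r * P := by
      rw [Finset.sum_comm, hP, Finset.mul_sum]
      refine Finset.sum_congr rfl fun g hg => ?_
      rw [← Finset.mul_sum, h1 g hg]
      ring
    rw [h6, Finset.sum_sub_distrib, Finset.sum_const, ← Finset.mul_sum, h7, nsmul_eq_mul]
    ring
  rw [h5, card_univ, Fintype.card_fin] at h4
  have h8 : n * ((n : ℝ) - 2) ≤ #(threeCyclesOn (univ : Finset (Fin n))) - r :=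
    le_of_mul_le_mul_right (by linarith) hPpos
  linarith

/-- The lift of a function on letters of sum zero along `g ↦ g i` is an eigenvector. -/
theorem exists_eigenvector_completeAlternatingGroupGraph (hn : 3 ≤ n) :
    ∃ f : alternatingGroup (Fin n) → ℝ, f ≠ 0 ∧
      (completeAlternatingGroupGraph n).adjMatrix ℝ *ᵥ f =
        (#(threeCyclesOn (univ : Finset (Fin n))) - n * ((n : ℝ) - 2)) • f := by
  have hcard : 2 ≤ Fintype.card (Fin n) := by simp; omega
  obtain ⟨a, b, hab⟩ := Fintype.exists_pair_of_one_lt_card (α := Fin n) (by omega)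
  set u : Fin n → ℝ := Pi.single a 1 - Pi.single b 1 with hu
  refine ⟨fun g => u ((g : Perm (Fin n)) a), Function.ne_iff.2 ⟨1, ?_⟩, funext fun γ => ?_⟩
  · simp [hu, hab]
  · rw [adjMatrix_completeAlternatingGroupGraph_mulVec (fun g => u (g a))]
    have h1 := sum_apply_threeCyclesOn_univ hcard a (fun x => u ((γ : Perm (Fin n)) x)) (by
      rw [Equiv.sum_comp (γ : Perm (Fin n)) u]
      simp [hu])
    simpa using h1

end Graph

theorem theorem3 (n : ℕ) (hn : 3 ≤ n) :
    (completeAlternatingGroupGraph n).adjEigenvalue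
        ⟨0, Nat.zero_lt_of_lt (one_lt_card_alternatingGroup hn)⟩ = 2 * (n.choose 3 : ℝ) ∧
    (completeAlternatingGroupGraph n).adjEigenvalue
        ⟨1, one_lt_card_alternatingGroup hn⟩ = (n : ℝ) * ((n : ℝ) - 2) * ((n : ℝ) - 4) / 3 ∧
    (completeAlternatingGroupGraph n).adjSpectralGap (one_lt_card_alternatingGroup hn) =
      (n : ℝ) ^ 2 - 2 * (n : ℝ) := by
  have hnR : (3 : ℝ) ≤ n := by exact_mod_cast hn
  have hT : (#(threeCyclesOn (univ : Finset (Fin n))) : ℝ) = 2 * (n.choose 3 : ℝ) := by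
    rw [card_threeCyclesOn_univ (by simpa using hn), Fintype.card_fin]
    push_cast
    rfl
  have hchoose : 2 * (n.choose 3 : ℝ) = n * (n - 1) * (n - 2) / 3 := by
    rw [Nat.cast_choose_eq_descPochhammer_div]
    simp [descPochhammer_succ_right, Nat.factorial]
    ring
  obtain ⟨h0, h1⟩ := (isHermitian_adjMatrix ℝ
    (completeAlternatingGroupGraph n)).eigenvalues₀_zero_one_eq (one_lt_card_alternatingGroup hn)
    (d := #(threeCyclesOn (univ : Finset (Fin n))))
    (m := #(threeCyclesOn (univ : Finset (Fin n))) - n * ((n : ℝ) - 2))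
    (by nlinarith)
    (funext fun γ => by
      rw [adjMatrix_completeAlternatingGroupGraph_mulVec (fun _ => 1)]
      simp)
    (fun f r hf hf0 h => eigenvalue_completeAlternatingGroupGraph_le hn hf hf0 h)
    (exists_eigenvector_completeAlternatingGroupGraph hn)
  refine ⟨h0.trans hT, ?_, ?_⟩
  · refine h1.trans ?_
    rw [hT, hchoose]
    ring
  · rw [adjSpectralGap, adjEigenvalue, adjEigenvalue, h0, h1]
    ring
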